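/- Let $H$ and $H'$ be Hilbert spaces over the same scalar field $\mathbb{F}\in\{\mathbb{R},\mathbb{C}\}$, and let $\pi:\mathcal{B}(H)\to\mathcal{B}(H')$ be a homomorphism (i.e. $\pi$ preserves addition, multiplication, adjoints and the identity operator) whose kernel is exactly the ideal $\mathcal{K}(H)$ of compact operators. Let $(P_n)_{n\in\mathbb{N}}$ be a sequence of orthogonal projections on $H$, write $\mathcal{R}(T)$ for the range of $T$, and let $\sum\mathcal{R}(P_n)$ denote the (possibly non-closed) algebraic linear span of the ranges $\mathcal{R}(P_n)$. For a sequence $(Q_n)$ of projections on a Hilbert space, $\bigvee Q_n$ denotes its least upper bound among all projections on that space, i.e. the projection onto $\overline{\sum\mathcal{R}(Q_n)}$. (1) Let $P$ be a projection on $H$ with $\mathcal{R}(P)\subseteq\sum\mathcal{R}(P_n)$. Then $\pi(P)=\bigvee\pi(P_n)$ if and only if $\mathcal{R}(P)$ has no closed infinite-dimensional extension in $\sum\mathcal{R}(P_n)$, i.e. there is no closed subspace $V$ with $\mathcal{R}(P)\subseteq V\subseteq\sum\mathcal{R}(P_n)$ and $V/\mathcal{R}(P)$ infinite-dimensional. (2)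 The subspace $\sum\mathcal{R}(P_n)$ is closed if and only if $\pi(\bigvee P_n)=\bigvee\pi(P_n)$. Both (1) and (2) also hold when "$\,\cdot=\bigvee\pi(P_n)$" is read as "$\,\cdot$ is the least upper bound of $(\pi(P_n))$ among the projections in $\pi[\mathcal{B}(H)]$", where $\pi[\mathcal{B}(H)]$ is isomorphic to the Calkin algebra $\mathcal{B}(H)/\mathcal{K}(H)$. In particular, $\sum\mathcal{R}(P_n)$ is closed if and only if the canonical map to the Calkin algebra preserves the least upper bound of $(P_n)$. -/

import Mathlib

section ProjectionJoins

variable {𝕜 E : Type*} [RCLike 𝕜] [NormedAddCommGroup E] [InnerProductSpace 𝕜 E] [CompleteSpace E]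

/-- `R` is the least upper bound of the sequence `Q` in the set `𝒫(A)` of (orthogonal) projections
that lie in `A ⊆ ℬ(E)`, for the usual order of operators. -/
def IsProjLUB (A : Set (E →L[𝕜] E)) (Q : ℕ → E →L[𝕜] E) (R : E →L[𝕜] E) : Prop :=
  IsLeast {T | T ∈ A ∧ IsStarProjection T ∧ ∀ n, Q n ≤ T} R

/-- The (possibly non-closed) algebraic linear span `∑ ℛ(Q n)` of the ranges. -/
def rangeSum (Q : ℕ → E →L[𝕜] E) : Submodule 𝕜 E := ⨆ n, (Q n).range

/-- The join `⋁ Q n`: the orthogonal projection onto the closure of `∑ ℛ(Q n)`. -/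
noncomputable def projJoin (Q : ℕ → E →L[𝕜] E) : E →L[𝕜] E :=
  (rangeSum Q).topologicalClosure.starProjection

/-- For a sequence of projections, `projJoin` is the least upper bound among all projections
on the Hilbert space. -/
theorem isProjLUB_projJoin (Q : ℕ → E →L[𝕜] E) (hQ : ∀ n, IsStarProjection (Q n)) :
    IsProjLUB Set.univ Q (projJoin Q) := by
  refine ⟨⟨trivial, isStarProjection_starProjection, fun n => ?_⟩, ?_⟩
  · obtain ⟨U, hU, h⟩ := isStarProjection_iff_eq_starProjection.1 (hQ n)
    rw [h]
    refine Submodule.starProjection_le_starProjection_iff.2 ?_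
    have h1 : U = (Q n).range := by rw [h, Submodule.range_starProjection]
    rw [h1]
    exact (le_iSup (fun n => (Q n).range) n).trans (Submodule.le_topologicalClosure _)
  · rintro T ⟨-, hT, hle⟩
    obtain ⟨V, hV, rfl⟩ := isStarProjection_iff_eq_starProjection.1 hT
    refine Submodule.starProjection_le_starProjection_iff.2 ?_
    refine Submodule.topologicalClosure_minimal _ (iSup_le fun n => ?_) ?_
    · obtain ⟨U, hU, h⟩ := isStarProjection_iff_eq_starProjection.1 (hQ n)
      have h2 := hle n
      rw [h] at h2 ⊢
      rw [Submodule.range_starProjection]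
      exact Submodule.starProjection_le_starProjection_iff.1 h2
    · rw [← V.orthogonal_orthogonal]
      exact Submodule.isClosed_orthogonal _

/-- `U` has a closed infinite dimensional extension in `W`: there is a closed subspace `V` with
`U ⊆ V ⊆ W` such that `V / U` is infinite dimensional. -/
def HasClosedInfDimExtension (U W : Submodule 𝕜 E) : Prop :=
  ∃ V : Submodule 𝕜 E, IsClosed (V : Set E) ∧ U ≤ V ∧ V ≤ W ∧
    ¬ FiniteDimensional 𝕜 (V ⧸ U.submoduleOf V)

end ProjectionJoins

/-! For projections `p`, `q` on `H`, `π p ≤ π q` means that `(1 - q) p` is compact. If `ℛ(R) ⊆ ∑ ℛ(P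
n)`, then uniform boundedness and a factorization write `R` as a finite sum of `Z n * P n`, so `π R`
lies below every upper bound of the `π (P n)`, inside or outside the image of `π`. Hence `π R` is
the join, in either reading, as soon as it is an upper bound. It fails to be one exactly when some
`(1 - R) P n` is noncompact. Such an operator is bounded below on an infinite-dimensional closed
subspace, whose image extends `ℛ(R)`; conversely, a closed extension `V` has `π` of its projection
below `π R`, which forces `V ∩ ker R` to be finite-dimensional. If the sum is closed, this applies
to `R = ⋁ P n`. If not, the sum contains an orthonormal sequence along which each `P m` is summable.
With `Y` its closed span, each `P m` is compact on `Y`, so the complement of `Y` gives an upper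
bound not above `π (⋁ P n)`. -/

/-! ### Compact operators on Hilbert space -/

section CompactOperators

variable {𝕜 E : Type*} [RCLike 𝕜] [NormedAddCommGroup E] [InnerProductSpace 𝕜 E]

/-- A compact operator fixes only finite-dimensional closed subspaces pointwise. -/
theorem IsCompactOperator.finiteDimensional_of_fixed {T : E →L[𝕜] E} (hT : IsCompactOperator T)
    {X : Submodule 𝕜 E} (hX : IsClosed (X : Set E)) (h : ∀ x ∈ X, T x = x) :
    FiniteDimensional 𝕜 X := by
  have h1 : IsCompactOperator (T ∘L X.subtypeL) := hT.comp_clm _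
  have h2 := h1.codRestrict (V := X) (fun x => by simp [h x x.2]) hX
  refine FiniteDimensional.of_isCompactOperator_id (𝕜 := 𝕜) (E := X) ?_
  have h3 : Set.codRestrict (T ∘L X.subtypeL) X (fun x => by simp [h x x.2]) = id :=
    funext fun x => Subtype.ext (h x x.2)
  rw [← h3]
  exact h2

variable [CompleteSpace E]

/-- An operator that is small on the orthogonal complements of suitable finite-dimensional
subspaces is compact. -/
theorem isCompactOperator_of_forall_orthogonal_norm_le (T : E →L[𝕜] E)
    (h : ∀ ε > 0, ∃ F : Submodule 𝕜 E, FiniteDimensional 𝕜 F ∧ ∀ x ∈ Fᗮ, ‖T x‖ ≤ ε * ‖x‖) :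
    IsCompactOperator T := by
  have hcl : IsClosed {S : E →L[𝕜] E | IsCompactOperator S} :=
    isClosed_setOfPred_isCompactOperator
  refine hcl.closure_subset (Metric.mem_closure_iff.2 fun ε hε => ?_)
  obtain ⟨F, hF, hT⟩ := h (ε / 2) (half_pos hε)
  refine ⟨T ∘L F.starProjection, ?_, ?_⟩
  · have : FiniteDimensional 𝕜 F := hF
    have : ProperSpace F := FiniteDimensional.proper_rclike 𝕜 F
    have h1 : IsCompactOperator (T ∘L F.subtypeL) :=
      isCompactOperator_of_locallyCompactSpace_rng (T ∘L F.subtypeL)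
    exact h1.comp_clm F.orthogonalProjectionOnto
  · rw [dist_eq_norm]
    refine lt_of_le_of_lt (ContinuousLinearMap.opNorm_le_bound _ (half_pos hε).le fun x => ?_)
      (half_lt_self hε)
    have h1 := hT _ (F.sub_starProjection_mem_orthogonal x)
    have h2 : ‖x - F.starProjection x‖ ≤ ‖x‖ := by
      rw [← Submodule.starProjection_orthogonal_val]
      exact Submodule.norm_starProjection_apply_le _ _
    calc ‖(T - T ∘L F.starProjection) x‖ = ‖T (x - F.starProjection x)‖ := by simp
      _ ≤ ε / 2 * ‖x - F.starProjection x‖ := h1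
      _ ≤ ε / 2 * ‖x‖ := by gcongr

/-- A noncompact operator is bounded below on some orthonormal sequence, whose image is
orthogonal too. -/
theorem exists_orthonormal_seq_of_not_isCompactOperator (T : E →L[𝕜] E)
    (hT : ¬ IsCompactOperator T) :
    ∃ ε > 0, ∃ x : ℕ → E, Orthonormal 𝕜 x ∧ (∀ n, ε ≤ ‖T (x n)‖) ∧
      Pairwise fun m n => inner 𝕜 (T (x m)) (T (x n)) = 0 := by
  classical
  have h : ∃ ε > 0, ∀ F : Submodule 𝕜 E, FiniteDimensional 𝕜 F →
      ∃ x ∈ Fᗮ, ε * ‖x‖ < ‖T x‖ := by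
    by_contra! h
    exact hT (isCompactOperator_of_forall_orthogonal_norm_le T h)
  obtain ⟨ε, hε, h⟩ := h
  have : Std.Symm (fun x y : E => inner 𝕜 x y = 0 ∧ inner 𝕜 (T x) (T y) = 0) :=
    ⟨fun _ _ h => ⟨inner_eq_zero_symm.1 h.1, inner_eq_zero_symm.1 h.2⟩⟩
  obtain ⟨x, hx, hr⟩ := exists_seq_of_forall_finset_exists'
    (fun y : E => ‖y‖ = 1 ∧ ε ≤ ‖T y‖)
    (fun x y : E => inner 𝕜 x y = 0 ∧ inner 𝕜 (T x) (T y) = 0) (by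
      intro s _
      -- Orthogonality to `T* T x` is what makes `T y` orthogonal to `T x`.
      obtain ⟨y, hy, hTy⟩ := h (Submodule.span 𝕜
        (↑(s ∪ s.image fun x => ContinuousLinearMap.adjoint T (T x)) : Set E))
        (FiniteDimensional.span_finset 𝕜 _)
      have hy0 : y ≠ 0 := by
        rintro rfl
        simp at hTy
      have hny : 0 < ‖y‖ := norm_pos_iff.2 hy0
      have horth : ∀ z ∈ s ∪ s.image fun x => ContinuousLinearMap.adjoint T (T x),
          inner 𝕜 z y = 0 := fun z hz =>
        (Submodule.mem_orthogonal _ _).1 hy z (Submodule.subset_span hz)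
      refine ⟨((‖y‖⁻¹ : ℝ) : 𝕜) • y, ⟨?_, ?_⟩, fun x hx => ⟨?_, ?_⟩⟩
      · rw [norm_smul, RCLike.norm_ofReal, abs_of_pos (inv_pos.2 hny), inv_mul_cancel₀ hny.ne']
      · rw [map_smul, norm_smul, RCLike.norm_ofReal, abs_of_pos (inv_pos.2 hny), inv_mul_eq_div,
          le_div_iff₀ hny]
        exact hTy.le
      · rw [inner_smul_right, horth x (Finset.mem_union_left _ hx), mul_zero]
      · rw [map_smul, inner_smul_right, ← ContinuousLinearMap.adjoint_inner_left,
          horth _ (Finset.mem_union_right _ (Finset.mem_image_of_mem _ hx)), mul_zero])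
  exact ⟨ε, hε, x, ⟨fun n => (hx n).1, fun m n hmn => (hr hmn).1⟩, fun n => (hx n).2,
    fun m n hmn => (hr hmn).2⟩

/-- A noncompact operator is bounded below on some closed infinite-dimensional subspace. -/
theorem exists_infinite_dimensional_bounded_below (T : E →L[𝕜] E) (hT : ¬ IsCompactOperator T) :
    ∃ ε > 0, ∃ X : Submodule 𝕜 E, IsClosed (X : Set E) ∧ ¬ FiniteDimensional 𝕜 X ∧
      ∀ x ∈ X, ε * ‖x‖ ≤ ‖T x‖ := by
  obtain ⟨ε, hε, x, hx, hTx, horth⟩ := exists_orthonormal_seq_of_not_isCompactOperator T hT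
  refine ⟨ε, hε, (Submodule.span 𝕜 (Set.range x)).topologicalClosure,
    Submodule.isClosed_topologicalClosure _, fun hfin => ?_, ?_⟩
  · have hli : LinearIndependent 𝕜 fun n => (⟨x n, Submodule.le_topologicalClosure _
        (Submodule.subset_span ⟨n, rfl⟩)⟩ : (Submodule.span 𝕜 (Set.range x)).topologicalClosure) :=
      LinearIndependent.of_comp (Submodule.subtype _) hx.linearIndependent
    exact not_finite_iff_infinite.2 inferInstance hli.finite
  · have key : ∀ y ∈ Submodule.span 𝕜 (Set.range x), ε * ‖y‖ ≤ ‖T y‖ := by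
      intro y hy
      obtain ⟨c, rfl⟩ := (Finsupp.mem_span_range_iff_exists_finsupp).1 hy
      have e1 : ∀ v : ℕ → E, (Pairwise fun m n => inner 𝕜 (v m) (v n) = 0) →
          ‖c.sum fun i a => a • v i‖ ^ 2 = ∑ i ∈ c.support, ‖c i‖ ^ 2 * ‖v i‖ ^ 2 := by
        intro v hv
        have := (OrthogonalFamily.of_pairwise (𝕜 := 𝕜) (V := fun n => Submodule.span 𝕜 {v n})
          (fun m n hmn => by
            refine Submodule.isOrtho_span.2 ?_
            simpa using hv hmn)).norm_sum (fun i => ⟨c i • v i, Submodule.smul_mem _ _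
              (Submodule.mem_span_singleton_self _)⟩) c.support
        simpa [Finsupp.sum, norm_smul, mul_pow] using this
      refine le_of_sq_le_sq ?_ (norm_nonneg _)
      rw [mul_pow, e1 x hx.2, map_finsuppSum]
      simp only [map_smul]
      rw [e1 (fun n => T (x n)) horth, Finset.mul_sum]
      refine Finset.sum_le_sum fun i _ => ?_
      rw [hx.1 i]
      have := pow_le_pow_left₀ hε.le (hTx i) 2
      nlinarith [sq_nonneg ‖c i‖]
    intro y hy
    exact closure_minimal (s := (Submodule.span 𝕜 (Set.range x) : Set E))
      (t := {y | ε * ‖y‖ ≤ ‖T y‖}) key (isClosed_le (by fun_prop) (by fun_prop)) hy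

end CompactOperators

/-! ### Range inclusion and factorization -/

section Factorization

variable {𝕜 E : Type*} [RCLike 𝕜] [NormedAddCommGroup E] [InnerProductSpace 𝕜 E] [CompleteSpace E]

/-- If a self-adjoint operator has its range in the algebraic span of the ranges of self-adjoint
operators `P n`, then it is dominated by finitely many of them. -/
theorem exists_norm_le_sum_of_range_le (P : ℕ → E →L[𝕜] E) (hP : ∀ n, IsSelfAdjoint (P n))
    (R : E →L[𝕜] E) (hR : IsSelfAdjoint R) (hle : R.range ≤ rangeSum P) :
    ∃ (N : ℕ) (C : ℝ), ∀ x, ‖R x‖ ≤ C * ∑ n ∈ Finset.range N, ‖P n x‖ := by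
  by_contra! h
  choose x hx using fun N : ℕ => h N N
  have hpos : ∀ N, 0 < ‖R (x N)‖ := fun N =>
    lt_of_le_of_lt (mul_nonneg N.cast_nonneg (Finset.sum_nonneg fun _ _ => norm_nonneg _)) (hx N)
  have hnorm : ∀ N : ℕ, ‖((N / ‖R (x N)‖ : ℝ) : 𝕜)‖ = N / ‖R (x N)‖ := fun N => by
    rw [RCLike.norm_ofReal, abs_of_nonneg (by positivity)]
  -- The scaling makes `‖R (z N)‖ = N` unbounded while `‖P n (z N)‖ ≤ 1` for `n < N`. So `z` is
  -- bounded against every vector of the sum, in particular against `ℛ(R)`, and Banach–Steinhaus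
  -- gives a contradiction.
  set z : ℕ → E := fun N => ((N / ‖R (x N)‖ : ℝ) : 𝕜) • x N with hz
  have hRz : ∀ N, ‖R (z N)‖ = N := fun N => by
    rw [hz, map_smul, norm_smul, hnorm, div_mul_cancel₀ _ (hpos N).ne']
  have hPz : ∀ N, ∀ n < N, ‖P n (z N)‖ ≤ 1 := fun N n hn => by
    rw [hz, map_smul, norm_smul, hnorm, div_mul_eq_mul_div, div_le_one (hpos N)]
    refine le_trans ?_ (hx N).le
    gcongr
    exact Finset.single_le_sum (f := fun n => ‖P n (x N)‖) (fun _ _ => norm_nonneg _)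
      (Finset.mem_range.2 hn)
  have hbd : ∀ w ∈ rangeSum P, ∃ C, ∀ N, ‖inner 𝕜 (z N) w‖ ≤ C := by
    intro w hw
    refine Submodule.iSup_induction (fun n => (P n).range)
      (motive := fun w => ∃ C, ∀ N, ‖inner 𝕜 (z N) w‖ ≤ C) hw ?_ ⟨0, by simp⟩ ?_
    · rintro n _ ⟨u, rfl⟩
      -- The finite sum covers the indices `N ≤ n`, where the bound by `1` is not available.
      refine ⟨(1 + ∑ N ∈ Finset.range (n + 1), ‖P n (z N)‖) * ‖u‖, fun N => ?_⟩
      have hsymm : inner 𝕜 (z N) (P n u) = inner 𝕜 (P n (z N)) u :=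
        ((hP n).isSymmetric (z N) u).symm
      change ‖inner 𝕜 (z N) (P n u)‖ ≤ _
      rw [hsymm]
      refine (norm_inner_le_norm _ _).trans ?_
      gcongr
      rcases lt_or_ge n N with hn | hn
      · exact (hPz N n hn).trans (le_add_of_nonneg_right
          (Finset.sum_nonneg fun _ _ => norm_nonneg _))
      · refine le_trans ?_ (le_add_of_nonneg_left zero_le_one)
        exact Finset.single_le_sum (f := fun N => ‖P n (z N)‖) (fun _ _ => norm_nonneg _)
          (Finset.mem_range.2 (Nat.lt_succ_of_le hn))
    · rintro v w ⟨C, hC⟩ ⟨D, hD⟩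
      refine ⟨C + D, fun N => ?_⟩
      rw [inner_add_right]
      exact (norm_add_le _ _).trans (add_le_add (hC N) (hD N))
  obtain ⟨C, hC⟩ := banach_steinhaus (g := fun N => innerSL 𝕜 (R (z N))) (fun y => by
    obtain ⟨C, hC⟩ := hbd (R y) (hle ⟨y, rfl⟩)
    refine ⟨C, fun N => ?_⟩
    have : inner 𝕜 (R (z N)) y = inner 𝕜 (z N) (R y) := hR.isSymmetric (z N) y
    rw [innerSL_apply_apply, this]
    exact hC N)
  obtain ⟨N, hN⟩ := exists_nat_gt C
  have := hC N
  rw [innerSL_apply_norm, hRz] at this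
  linarith

/-- An operator dominated by finitely many operators `P n` lies in the left ideal which they
generate. -/
theorem exists_eq_sum_comp_of_norm_le (P : ℕ → E →L[𝕜] E) (R : E →L[𝕜] E) (N : ℕ) (C : ℝ)
    (h : ∀ x, ‖R x‖ ≤ C * ∑ n ∈ Finset.range N, ‖P n x‖) :
    ∃ Z : Fin N → E →L[𝕜] E, R = ∑ n, Z n * P n := by
  let ι : Fin N → E →L[𝕜] PiLp 2 (fun _ : Fin N => E) := fun n =>
    (PiLp.continuousLinearEquiv 2 𝕜 (fun _ : Fin N => E)).symm.toContinuousLinearMap ∘L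
      ContinuousLinearMap.single 𝕜 (fun _ : Fin N => E) n
  -- Douglas factorization: `R` is dominated by the column `e` of the `P n`, so `e x ↦ R x` is well
  -- defined and bounded. It extends to the closure of the range of `e`, then by the orthogonal
  -- projection to the whole space.
  let e : E →L[𝕜] PiLp 2 (fun _ : Fin N => E) := ∑ n, ι n ∘L P n
  have he : ∀ x n, e x n = P n x := by
    intro x n
    simp [e, ι, Pi.single_apply]
  let K := e.range.topologicalClosure
  have hmem : ∀ x, e x ∈ K := fun x => Submodule.le_topologicalClosure _ ⟨x, rfl⟩
  let e' : E →ₗ[𝕜] K := e.toLinearMap.codRestrict K hmem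
  have hdense : DenseRange e' := by
    intro y
    rw [Metric.mem_closure_iff]
    intro ε hε
    obtain ⟨_, ⟨x, rfl⟩, hd⟩ := Metric.mem_closure_iff.1 y.2 ε hε
    exact ⟨e' x, ⟨x, rfl⟩, hd⟩
  have hbound : ∀ x, ‖R.toLinearMap x‖ ≤ (|C| * N) * ‖e' x‖ := by
    intro x
    refine (h x).trans ?_
    rw [mul_assoc]
    refine mul_le_mul (le_abs_self C) ?_ (Finset.sum_nonneg fun _ _ => norm_nonneg _)
      (abs_nonneg C)
    rw [Finset.sum_range]
    have : ∀ n ∈ (Finset.univ : Finset (Fin N)), ‖P n x‖ ≤ ‖e x‖ := fun n _ => by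
      rw [← he]
      exact PiLp.norm_apply_le (e x) n
    change _ ≤ N * ‖e x‖
    simpa using Finset.sum_le_card_nsmul _ _ _ this
  let Z := (R.toLinearMap.extendOfNorm e') ∘L K.orthogonalProjectionOnto
  have hZ : ∀ x, Z (e x) = R x := by
    intro x
    have h1 : K.orthogonalProjectionOnto (e x) = e' x :=
      K.orthogonalProjectionOnto_mem_subspace_eq_self ⟨e x, hmem x⟩
    change R.toLinearMap.extendOfNorm e' (K.orthogonalProjectionOnto (e x)) = R x
    rw [h1]
    exact LinearMap.extendOfNorm_eq hdense ⟨_, hbound⟩ x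
  refine ⟨fun n => Z ∘L ι n, ?_⟩
  ext x
  rw [← hZ]
  simp [e]

/-- An operator with range in the algebraic span of the ranges of the `P n` lies in the left ideal
generated by finitely many `P n`. -/
theorem exists_eq_sum_comp_of_range_le (P : ℕ → E →L[𝕜] E) (hP : ∀ n, IsSelfAdjoint (P n))
    (R : E →L[𝕜] E) (hR : IsSelfAdjoint R) (hle : R.range ≤ rangeSum P) :
    ∃ (N : ℕ) (Z : Fin N → E →L[𝕜] E), R = ∑ n, Z n * P n := by
  obtain ⟨N, C, h⟩ := exists_norm_le_sum_of_range_le P hP R hR hle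
  exact ⟨N, exists_eq_sum_comp_of_norm_le P R N C h⟩

end Factorization

/-! ### Closedness of the sum of ranges -/

section RangeSum

variable {𝕜 E : Type*} [RCLike 𝕜] [NormedAddCommGroup E] [InnerProductSpace 𝕜 E] [CompleteSpace E]

theorem IsStarProjection.re_inner_apply_self {p : E →L[𝕜] E} (hp : IsStarProjection p) (x : E) :
    RCLike.re (inner 𝕜 (p x) x) = ‖p x‖ ^ 2 := by
  have h1 : p (p x) = p x := DFunLike.congr_fun hp.isIdempotentElem.eq x
  have h2 : inner 𝕜 (p (p x)) x = inner 𝕜 (p x) (p x) := hp.isSelfAdjoint.isSymmetric (p x) x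
  rw [← h1, h2, h1, inner_self_eq_norm_sq]

theorem IsStarProjection.norm_apply_le {p : E →L[𝕜] E} (hp : IsStarProjection p) (x : E) :
    ‖p x‖ ≤ ‖x‖ := by
  obtain ⟨U, hU, rfl⟩ := isStarProjection_iff_eq_starProjection.1 hp
  exact U.norm_starProjection_apply_le x

/-- The span of the ranges of projections `P n` is closed as soon as finitely many `P n` are jointly
bounded below on it, up to a finite-dimensional subspace. -/
theorem isClosed_rangeSum_of_le (P : ℕ → E →L[𝕜] E) (hP : ∀ n, IsStarProjection (P n))
    (F : Submodule 𝕜 E) [FiniteDimensional 𝕜 F] (hF : F ≤ rangeSum P) (N : ℕ) {ε : ℝ} (hε : 0 < ε)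
    (h : ∀ y ∈ rangeSum P, y ∈ Fᗮ → ε * ‖y‖ ≤ ∑ n ∈ Finset.range N, ‖P n y‖) :
    IsClosed (rangeSum P : Set E) := by
  set W := rangeSum P with hW
  let K := W.topologicalClosure
  have hFP : IsStarProjection F.starProjection := isStarProjection_starProjection
  -- `A` maps into `W` and will be coercive on the closure `K`. By Lax–Milgram it is onto `K`, hence
  -- `K ⊆ W`.
  let A : E →L[𝕜] E := F.starProjection + ∑ n ∈ Finset.range N, P n
  have hA : ∀ x, A x ∈ W := fun x => by
    simp only [A, add_apply, sum_apply]
    exact W.add_mem (hF (F.starProjection_apply_mem x)) (W.sum_mem fun n _ =>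
      (le_iSup (fun n => (P n).range) n) ⟨x, rfl⟩)
  have hre : ∀ x, RCLike.re (inner 𝕜 (A x) x) =
      ‖F.starProjection x‖ ^ 2 + ∑ n ∈ Finset.range N, ‖P n x‖ ^ 2 := fun x => by
    simp only [A, add_apply, sum_apply, inner_add_left,
      sum_inner, map_add, map_sum, hFP.re_inner_apply_self, (hP _).re_inner_apply_self]
  -- Splitting `y` along `F` gives the coefficient `ε + N` for the `F`-part and `1` for the sum; `M`
  -- dominates both.
  set M : ℝ := ε + N + 1 with hM
  have hMpos : 0 < M := by positivity
  have hlow : ∀ y ∈ W,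
      ε * ‖y‖ ≤ M * (‖F.starProjection y‖ + ∑ n ∈ Finset.range N, ‖P n y‖) := by
    intro y hy
    have h1 := h (y - F.starProjection y) (W.sub_mem hy (hF (F.starProjection_apply_mem y)))
      (F.sub_starProjection_mem_orthogonal y)
    have h2 : ‖y‖ ≤ ‖F.starProjection y‖ + ‖y - F.starProjection y‖ := by
      simpa using norm_add_le (F.starProjection y) (y - F.starProjection y)
    have h3 : ∑ n ∈ Finset.range N, ‖P n (y - F.starProjection y)‖ ≤
        ∑ n ∈ Finset.range N, ‖P n y‖ + N * ‖F.starProjection y‖ := by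
      calc _ ≤ ∑ n ∈ Finset.range N, (‖P n y‖ + ‖F.starProjection y‖) :=
            Finset.sum_le_sum fun n _ => by
              rw [map_sub]
              exact (norm_sub_le _ _).trans (add_le_add le_rfl ((hP n).norm_apply_le _))
        _ = _ := by simp [Finset.sum_add_distrib]
    have h4 : 0 ≤ ∑ n ∈ Finset.range N, ‖P n y‖ := Finset.sum_nonneg fun _ _ => norm_nonneg _
    have h5 : (0 : ℝ) ≤ N := N.cast_nonneg
    have h6 := norm_nonneg (F.starProjection y)
    nlinarith [mul_le_mul_of_nonneg_left h2 hε.le, mul_nonneg h5 h4, mul_nonneg hε.le h4]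
  -- The factor `2 * (N + 1)` comes from `(a + b)² ≤ 2a² + 2b²` and Cauchy–Schwarz on `N` terms.
  have hlow' : ∀ y ∈ W, ε ^ 2 * ‖y‖ ^ 2 ≤ M ^ 2 * (2 * (N + 1)) * RCLike.re (inner 𝕜 (A y) y) := by
    intro y hy
    rw [hre]
    have h1 := pow_le_pow_left₀ (by positivity) (hlow y hy) 2
    have h2 : (∑ n ∈ Finset.range N, ‖P n y‖) ^ 2 ≤ N * ∑ n ∈ Finset.range N, ‖P n y‖ ^ 2 := by
      simpa using sq_sum_le_card_mul_sum_sq (s := Finset.range N) (f := fun n => ‖P n y‖)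
    have h3 : 0 ≤ ∑ n ∈ Finset.range N, ‖P n y‖ ^ 2 := Finset.sum_nonneg fun _ _ => sq_nonneg _
    rw [mul_pow, mul_pow] at h1
    refine h1.trans ?_
    rw [mul_assoc]
    refine mul_le_mul_of_nonneg_left ?_ (sq_nonneg M)
    have h5 : (0 : ℝ) ≤ N := N.cast_nonneg
    nlinarith [sq_nonneg (‖F.starProjection y‖ - ∑ n ∈ Finset.range N, ‖P n y‖),
      mul_nonneg h5 (sq_nonneg ‖F.starProjection y‖)]
  have hlowK : ∀ y ∈ K, ε ^ 2 * ‖y‖ ^ 2 ≤ M ^ 2 * (2 * (N + 1)) * RCLike.re (inner 𝕜 (A y) y) := by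
    intro y hy
    exact closure_minimal (s := (W : Set E)) hlow' (isClosed_le (by fun_prop)
      (continuous_const.mul (RCLike.continuous_re.comp (by fun_prop)))) hy
  let B : K →L[𝕜] K := K.orthogonalProjectionOnto ∘L A ∘L K.subtypeL
  have hB : ∀ x : K, (B x : E) = A x := fun x =>
    congrArg Subtype.val (K.orthogonalProjectionOnto_mem_subspace_eq_self
      ⟨A x, W.le_topologicalClosure (hA x)⟩)
  have hcpos : 0 < ε ^ 2 / (M ^ 2 * (2 * (N + 1))) := by positivity
  have hunit : IsUnit B := by
    refine ContinuousLinearMap.isUnit_of_forall_le_norm_inner_map B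
      (c := ⟨ε ^ 2 / (M ^ 2 * (2 * (N + 1))), hcpos.le⟩) hcpos fun x => ?_
    refine le_trans ?_ (RCLike.re_le_norm _)
    rw [Submodule.coe_inner, hB]
    have := hlowK x x.2
    change ‖(x : E)‖ ^ 2 * (ε ^ 2 / (M ^ 2 * (2 * (N + 1)))) ≤ _
    rw [← mul_div_assoc, div_le_iff₀ (by positivity)]
    linarith
  have hKW : K = W := by
    refine le_antisymm (fun y hy => ?_) W.le_topologicalClosure
    obtain ⟨x, hx⟩ := (ContinuousLinearMap.isUnit_iff_bijective.1 hunit).2 ⟨y, hy⟩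
    have hy' : y = A x := by simpa [hx] using hB x
    rw [hy']
    exact hA x
  rw [← hKW]
  exact W.isClosed_topologicalClosure

/-- If the span of the ranges of projections `P n` is not closed, then it contains an orthonormal
sequence along which every `P n` tends to zero fast. -/
theorem exists_orthonormal_seq_of_not_isClosed_rangeSum (P : ℕ → E →L[𝕜] E)
    (hP : ∀ n, IsStarProjection (P n)) (h : ¬ IsClosed (rangeSum P : Set E)) :
    ∃ y : ℕ → E, Orthonormal 𝕜 y ∧ (∀ k, y k ∈ rangeSum P) ∧
      ∀ m, Summable fun k => ‖P m (y k)‖ := by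
  classical
  -- Each vector carries a strictly increasing index `n`, which serves both as the range of
  -- controlled `m` and as the exponent of the bound. A next vector exists because the closedness
  -- criterion fails for the span of the earlier ones with `ε = 2⁻ⁿ`.
  obtain ⟨f, hf, hr⟩ := exists_seq_of_forall_finset_exists
    (fun a : ℕ × E => a.2 ∈ rangeSum P ∧ ‖a.2‖ = 1 ∧ ∀ m ≤ a.1, ‖P m a.2‖ ≤ (1 / 2) ^ a.1)
    (fun a b => a.1 < b.1 ∧ inner 𝕜 a.2 b.2 = 0) (by
      intro s hs
      set n := s.sup Prod.fst + 1 with hn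
      have hfd : FiniteDimensional 𝕜 (Submodule.span 𝕜 (↑(s.image Prod.snd) : Set E)) :=
        FiniteDimensional.span_finset 𝕜 _
      have hsW : Submodule.span 𝕜 (↑(s.image Prod.snd) : Set E) ≤ rangeSum P := by
        rw [Submodule.span_le]
        intro z hz
        obtain ⟨a, ha, rfl⟩ := Finset.mem_image.1 (Finset.mem_coe.1 hz)
        exact (hs a ha).1
      have h1 : ∃ y ∈ rangeSum P, y ∈ (Submodule.span 𝕜 (↑(s.image Prod.snd) : Set E))ᗮ ∧
          ∑ m ∈ Finset.range (n + 1), ‖P m y‖ < (1 / 2 : ℝ) ^ n * ‖y‖ := by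
        by_contra! hcon
        exact h (isClosed_rangeSum_of_le P hP _ hsW (n + 1) (by positivity) hcon)
      obtain ⟨y, hyW, hyF, hy⟩ := h1
      have hny : 0 < ‖y‖ := by
        by_contra! h0
        have : 0 ≤ ∑ m ∈ Finset.range (n + 1), ‖P m y‖ := Finset.sum_nonneg fun _ _ => norm_nonneg _
        rw [le_antisymm h0 (norm_nonneg _), mul_zero] at hy
        linarith
      have hc : ‖((‖y‖⁻¹ : ℝ) : 𝕜)‖ = ‖y‖⁻¹ := by
        rw [RCLike.norm_ofReal, abs_of_pos (inv_pos.2 hny)]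
      refine ⟨(n, ((‖y‖⁻¹ : ℝ) : 𝕜) • y), ⟨Submodule.smul_mem _ _ hyW, ?_, fun m hm => ?_⟩,
        fun a ha => ⟨Nat.lt_succ_of_le (Finset.le_sup (f := Prod.fst) ha), ?_⟩⟩
      · rw [norm_smul, hc, inv_mul_cancel₀ hny.ne']
      · rw [map_smul, norm_smul, hc, inv_mul_eq_div, div_le_iff₀ hny]
        exact (Finset.single_le_sum (f := fun m => ‖P m y‖) (fun _ _ => norm_nonneg _)
          (Finset.mem_range.2 (Nat.lt_succ_of_le hm))).trans hy.le
      · rw [inner_smul_right, (Submodule.mem_orthogonal _ _).1 hyF _ (Submodule.subset_span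
          (Finset.mem_coe.2 (Finset.mem_image_of_mem _ ha))), mul_zero])
  have hmono : StrictMono fun k => (f k).1 := fun m n hmn => (hr m n hmn).1
  refine ⟨fun k => (f k).2, ⟨fun k => (hf k).2.1, fun m n hmn => ?_⟩, fun k => (hf k).1,
    fun m => ?_⟩
  · rcases lt_or_gt_of_ne hmn with hlt | hlt
    · exact (hr _ _ hlt).2
    · exact inner_eq_zero_symm.1 (hr _ _ hlt).2
  · refine Summable.of_norm_bounded_eventually_nat summable_geometric_two ?_
    filter_upwards [Filter.eventually_ge_atTop m] with k hk
    rw [norm_norm]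
    have hk' : k ≤ (f k).1 := hmono.id_le k
    exact ((hf k).2.2 m (hk.trans hk')).trans
      (pow_le_pow_of_le_one (by norm_num) (by norm_num) hk')

/-- An operator that is absolutely summable along an orthonormal sequence is compact on its closed
span. -/
theorem isCompactOperator_comp_starProjection_of_summable (T : E →L[𝕜] E) {y : ℕ → E}
    (hy : Orthonormal 𝕜 y) (hT : Summable fun k => ‖T (y k)‖) :
    IsCompactOperator
      (T ∘L (Submodule.span 𝕜 (Set.range y)).topologicalClosure.starProjection) := by
  set Y := (Submodule.span 𝕜 (Set.range y)).topologicalClosure with hY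
  -- The operator is the norm-convergent sum of the rank-one operators `⟨y k, ·⟩ T (y k)`.
  let g : ℕ → E →L[𝕜] E := fun k => (innerSL 𝕜 (y k)).smulRight (T (y k))
  have hgs : Summable g := by
    refine Summable.of_norm_bounded hT fun k => le_of_eq ?_
    simp [g, ContinuousLinearMap.norm_smulRight_apply, hy.1 k]
  have hgc : ∀ k, IsCompactOperator (g k) := fun k => by
    have h1 : IsCompactOperator (innerSL 𝕜 (y k)) :=
      isCompactOperator_of_locallyCompactSpace_dom _
    exact h1.clm_comp (ContinuousLinearMap.toSpanSingleton 𝕜 (T (y k)))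
  have hsum : IsCompactOperator (∑' k, g k : E →L[𝕜] E) := by
    refine isCompactOperator_of_tendsto hgs.hasSum.tendsto_sum_nat (Filter.Eventually.of_forall
      fun n => ?_)
    exact (compactOperator (RingHom.id 𝕜) E E).sum_mem fun k _ => hgc k
  convert hsum using 2
  have happ : ∀ x, (∑' k, g k) x = ∑' k, inner 𝕜 (y k) x • T (y k) := fun x =>
    (hgs.hasSum.mapL (ContinuousLinearMap.apply 𝕜 E x)).tsum_eq.symm
  have hspan : ∀ x ∈ Y, T x = (∑' k, g k) x := by
    intro x hx
    refine closure_minimal (s := (Submodule.span 𝕜 (Set.range y) : Set E))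
      (t := {x | T x = (∑' k, g k) x}) (fun x hx => ?_) (isClosed_eq (by fun_prop) (by fun_prop)) hx
    have : Set.EqOn T (∑' k, g k : E →L[𝕜] E) (Set.range y) := by
      rintro _ ⟨j, rfl⟩
      rw [happ, tsum_eq_single j]
      · simp [hy.1 j]
      · intro k hk
        simp [orthonormal_iff_ite.1 hy, hk]
    exact LinearMap.eqOn_span this hx
  ext x
  change T (Y.starProjection x) = _
  rw [hspan _ (Y.starProjection_apply_mem x), happ, happ]
  congr 1
  ext k
  have hyk : y k ∈ Y := Submodule.le_topologicalClosure _ (Submodule.subset_span ⟨k, rfl⟩)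
  have h0 : inner 𝕜 (y k) (x - Y.starProjection x) = 0 :=
    (Submodule.mem_orthogonal _ _).1 (Y.sub_starProjection_mem_orthogonal x) _ hyk
  rw [inner_sub_right, sub_eq_zero] at h0
  rw [h0]

end RangeSum

/-! ### Projections modulo compact operators -/

section Calkin

variable {𝕜 H H' : Type*} [RCLike 𝕜]
  [NormedAddCommGroup H] [InnerProductSpace 𝕜 H] [CompleteSpace H]
  [NormedAddCommGroup H'] [InnerProductSpace 𝕜 H'] [CompleteSpace H']

/-- The order of projections is given by multiplication from the left. -/
theorem IsStarProjection.clm_le_iff_mul_eq {p q : H →L[𝕜] H} (hp : IsStarProjection p)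
    (hq : IsStarProjection q) : p ≤ q ↔ q * p = p := by
  obtain ⟨U, hU, rfl⟩ := isStarProjection_iff_eq_starProjection.1 hp
  obtain ⟨V, hV, rfl⟩ := isStarProjection_iff_eq_starProjection.1 hq
  rw [Submodule.starProjection_le_starProjection_iff]
  constructor
  · intro h
    ext x
    exact V.starProjection_eq_self_iff.2 (h (U.starProjection_apply_mem x))
  · intro h x hx
    have := DFunLike.congr_fun h x
    rw [mul_apply_eq_comp, U.starProjection_eq_self_iff.2 hx] at this
    exact V.starProjection_eq_self_iff.1 this

/-- The order of projections is given by multiplication from the right. -/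
theorem IsStarProjection.clm_le_iff_mul_eq' {p q : H →L[𝕜] H} (hp : IsStarProjection p)
    (hq : IsStarProjection q) : p ≤ q ↔ p * q = p := by
  rw [hp.clm_le_iff_mul_eq hq, ← star_inj, star_mul, hp.isSelfAdjoint.star_eq,
    hq.isSelfAdjoint.star_eq]

theorem IsStarProjection.isClosed_range {p : H →L[𝕜] H} (hp : IsStarProjection p) :
    IsClosed (p.range : Set H) := by
  obtain ⟨U, hU, rfl⟩ := isStarProjection_iff_eq_starProjection.1 hp
  rw [Submodule.range_starProjection, ← U.orthogonal_orthogonal]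
  exact Submodule.isClosed_orthogonal _

theorem IsStarProjection.apply_eq_self {p : H →L[𝕜] H} (hp : IsStarProjection p) {x : H}
    (hx : x ∈ p.range) : p x = x := by
  obtain ⟨y, rfl⟩ := hx
  exact DFunLike.congr_fun hp.isIdempotentElem.eq y

theorem IsStarProjection.apply_apply {p : H →L[𝕜] H} (hp : IsStarProjection p) (x : H) :
    p (p x) = p x :=
  hp.apply_eq_self ⟨x, rfl⟩

theorem IsStarProjection.map_of_map_star {π : (H →L[𝕜] H) →+* (H' →L[𝕜] H')}
    (hstar : ∀ T, π (star T) = star (π T)) {p : H →L[𝕜] H} (hp : IsStarProjection p) :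
    IsStarProjection (π p) where
  isIdempotentElem := hp.isIdempotentElem.map π
  isSelfAdjoint := by rw [IsSelfAdjoint, ← hstar, hp.isSelfAdjoint.star_eq]

/-- For projections `p`, `q`, one has `π p ≤ π q` if and only if `(1 - q) p` is compact. -/
theorem map_le_map_iff_isCompactOperator {π : (H →L[𝕜] H) →+* (H' →L[𝕜] H')}
    (hstar : ∀ T, π (star T) = star (π T)) (hker : ∀ T, π T = 0 ↔ IsCompactOperator T)
    {p q : H →L[𝕜] H} (hp : IsStarProjection p) (hq : IsStarProjection q) :
    π p ≤ π q ↔ IsCompactOperator ((1 - q) * p : H →L[𝕜] H) := by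
  rw [(hp.map_of_map_star hstar).clm_le_iff_mul_eq (hq.map_of_map_star hstar), ← hker, sub_mul,
    one_mul, map_sub, map_mul, sub_eq_zero, eq_comm]

/-- A projection with range in `∑ ℛ(P n)` is mapped below every upper bound of the `π (P n)`. -/
theorem map_le_of_range_le_rangeSum {π : (H →L[𝕜] H) →+* (H' →L[𝕜] H')}
    (hstar : ∀ T, π (star T) = star (π T)) {P : ℕ → H →L[𝕜] H} (hP : ∀ n, IsStarProjection (P n))
    {R : H →L[𝕜] H} (hR : IsStarProjection R) (hle : R.range ≤ rangeSum P)
    {T : H' →L[𝕜] H'} (hT : IsStarProjection T) (hPT : ∀ n, π (P n) ≤ T) : π R ≤ T := by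
  rw [(hR.map_of_map_star hstar).clm_le_iff_mul_eq' hT]
  obtain ⟨N, Z, hZ⟩ := exists_eq_sum_comp_of_range_le P (fun n => (hP n).isSelfAdjoint) R
    hR.isSelfAdjoint hle
  -- With the `P n` as right factors, `π (P n) * T = π (P n)` yields `π R * T = π R` for any
  -- projection `T` on `H'`.
  rw [hZ, map_sum, Finset.sum_mul]
  refine Finset.sum_congr rfl fun n _ => ?_
  rw [map_mul, mul_assoc, (((hP n).map_of_map_star hstar).clm_le_iff_mul_eq' hT).1 (hPT n)]

/-- The quotient of `V` by the range of a projection `R` is spanned by `V ∩ ker R`. -/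
theorem finiteDimensional_quotient_range_of_inf_ker {R : H →L[𝕜] H} (hR : IsStarProjection R)
    {V : Submodule 𝕜 H} (hV : R.range ≤ V)
    (hfin : FiniteDimensional 𝕜 (V ⊓ R.ker : Submodule 𝕜 H)) :
    FiniteDimensional 𝕜 (V ⧸ R.range.submoduleOf V) := by
  refine Module.Finite.of_surjective ((R.range.submoduleOf V).mkQ ∘ₗ
    Submodule.inclusion (inf_le_left : V ⊓ R.ker ≤ V)) fun v => ?_
  obtain ⟨v, rfl⟩ := Submodule.mkQ_surjective _ v
  have hRv : R v ∈ V := hV ⟨v, rfl⟩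
  refine ⟨⟨v - R v, V.sub_mem v.2 hRv, ?_⟩, ?_⟩
  · change R (v - R v) = 0
    rw [map_sub, hR.apply_apply, sub_self]
  · refine (Submodule.Quotient.eq _).2 ?_
    change (v - R v - v : H) ∈ R.range
    rw [sub_sub_cancel_left]
    exact R.range.neg_mem ⟨v, rfl⟩

/-- For a projection `R` with range in `∑ ℛ(P n)`, the projection `π R` dominates all `π (P n)` if
and only if `ℛ(R)` has no closed infinite-dimensional extension in `∑ ℛ(P n)`. -/
theorem forall_map_le_iff_not_hasClosedInfDimExtension {π : (H →L[𝕜] H) →+* (H' →L[𝕜] H')}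
    (hstar : ∀ T, π (star T) = star (π T)) (hker : ∀ T, π T = 0 ↔ IsCompactOperator T)
    {P : ℕ → H →L[𝕜] H} (hP : ∀ n, IsStarProjection (P n))
    {R : H →L[𝕜] H} (hR : IsStarProjection R) (hle : R.range ≤ rangeSum P) :
    (∀ n, π (P n) ≤ π R) ↔ ¬ HasClosedInfDimExtension R.range (rangeSum P) := by
  constructor
  · rintro h ⟨V, hVc, hRV, hVW, hinf⟩
    have : CompleteSpace V := hVc.completeSpace_coe
    have hS : IsStarProjection V.starProjection := isStarProjection_starProjection
    -- The projection onto `V` also has its range in the sum, so its image lies below the upper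
    -- bound `π R`.
    have hSR := map_le_of_range_le_rangeSum hstar hP hS
      (by rwa [Submodule.range_starProjection]) (hR.map_of_map_star hstar) h
    rw [map_le_map_iff_isCompactOperator hstar hker hS hR] at hSR
    refine hinf (finiteDimensional_quotient_range_of_inf_ker hR hRV
      (hSR.finiteDimensional_of_fixed (hVc.inter R.isClosed_ker) fun x hx => ?_))
    have h1 : V.starProjection x = x := V.starProjection_eq_self_iff.2 hx.1
    have h2 : R x = 0 := hx.2
    simp [h1, h2]
  · intro h n
    rw [map_le_map_iff_isCompactOperator hstar hker (hP n) hR]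
    by_contra hnc
    obtain ⟨ε, hε, X, hXc, hXinf, hX⟩ := exists_infinite_dimensional_bounded_below _ hnc
    set T : H →L[𝕜] H := (1 - R) * P n with hT
    have hRT : ∀ x, R (T x) = 0 := fun x => by
      change R (P n x - R (P n x)) = 0
      rw [map_sub, hR.apply_apply, sub_self]
    have : CompleteSpace X := hXc.completeSpace_coe
    have hanti : AntilipschitzWith (Real.toNNReal ε⁻¹) (T ∘L X.subtypeL) := by
      refine AddMonoidHomClass.antilipschitz_of_bound _ fun x => ?_
      rw [Real.coe_toNNReal _ (inv_pos.2 hε).le, inv_mul_eq_div, le_div_iff₀ hε, mul_comm]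
      exact hX x x.2
    have hYc : IsClosed ((T ∘L X.subtypeL).range : Set H) := by
      rw [LinearMap.coe_range]
      exact hanti.isClosed_range (T ∘L X.subtypeL).uniformContinuous
    set Y := (T ∘L X.subtypeL).range with hY
    have hYker : Y ≤ R.ker := by
      rintro _ ⟨x, rfl⟩
      exact hRT x
    have hYW : Y ≤ rangeSum P := by
      rintro _ ⟨x, rfl⟩
      change P n x - R (P n x) ∈ rangeSum P
      exact Submodule.sub_mem _ (le_iSup (fun n => (P n).range) n ⟨x, rfl⟩) (hle ⟨_, rfl⟩)
    have hYinf : ¬ FiniteDimensional 𝕜 Y := fun hfin =>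
      hXinf (LinearEquiv.ofInjective (T ∘L X.subtypeL).toLinearMap
        hanti.injective).symm.finiteDimensional
    refine h ⟨R.range ⊔ Y, ?_, le_sup_left, sup_le hle hYW, fun hfin => hYinf ?_⟩
    -- Since `Y ⊆ ker R`, the sum is the preimage of the closed `Y` under `1 - R`, hence closed.
    · have heq : ((R.range ⊔ Y : Submodule 𝕜 H) : Set H) = (fun x => x - R x) ⁻¹' Y := by
        ext z
        simp only [SetLike.mem_coe, Set.mem_preimage, Submodule.mem_sup]
        constructor
        · rintro ⟨r, hr, y, hy, rfl⟩
          have h1 : R y = 0 := hYker hy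
          simpa [hR.apply_eq_self hr, h1] using hy
        · intro hz
          exact ⟨R z, ⟨z, rfl⟩, z - R z, hz, by abel⟩
      rw [heq]
      exact hYc.preimage (by fun_prop)
    · refine Module.Finite.of_injective ((R.range.submoduleOf (R.range ⊔ Y)).mkQ ∘ₗ
        Submodule.inclusion (le_sup_right : Y ≤ R.range ⊔ Y)) ?_
      refine (injective_iff_map_eq_zero _).2 fun y hy => ?_
      have h1 : (y : H) ∈ R.range :=
        (Submodule.Quotient.mk_eq_zero (R.range.submoduleOf (R.range ⊔ Y))).1 hy
      have h2 : R y = 0 := hYker y.2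
      rw [hR.apply_eq_self h1] at h2
      exact Subtype.ext h2

/-- If `∑ ℛ(P n)` is not closed, some projection `S` satisfies `π (P n) ≤ π S` for all `n` but not
`π (⋁ P n) ≤ π S`. -/
theorem exists_map_le_and_not_map_projJoin_le {π : (H →L[𝕜] H) →+* (H' →L[𝕜] H')}
    (hstar : ∀ T, π (star T) = star (π T)) (hker : ∀ T, π T = 0 ↔ IsCompactOperator T)
    {P : ℕ → H →L[𝕜] H} (hP : ∀ n, IsStarProjection (P n))
    (h : ¬ IsClosed (rangeSum P : Set H)) :
    ∃ S : H →L[𝕜] H, IsStarProjection S ∧ (∀ n, π (P n) ≤ π S) ∧ ¬ π (projJoin P) ≤ π S := by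
  obtain ⟨y, hy, hyW, hsum⟩ := exists_orthonormal_seq_of_not_isClosed_rangeSum P hP h
  set Y := (Submodule.span 𝕜 (Set.range y)).topologicalClosure with hY
  have hYp : IsStarProjection Y.starProjection := isStarProjection_starProjection
  have hS : IsStarProjection (1 - Y.starProjection) := hYp.one_sub
  refine ⟨1 - Y.starProjection, hS, fun n => ?_, fun hle => ?_⟩
  · have h1 := isCompactOperator_comp_starProjection_of_summable (P n) hy (hsum n)
    rw [← hker, ← ContinuousLinearMap.mul_def, map_mul] at h1
    -- Summability gives compactness of `P n` after the projection onto `Y`; the order criterion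
    -- needs the reverse product, its adjoint.
    have h2 := congrArg star h1
    rw [star_mul, star_zero, ← hstar, ← hstar, hYp.isSelfAdjoint.star_eq,
      (hP n).isSelfAdjoint.star_eq] at h2
    rw [map_le_map_iff_isCompactOperator hstar hker (hP n) hS, sub_sub_cancel, ← hker, map_mul, h2]
  · have hJ : IsStarProjection (projJoin P) := isStarProjection_starProjection
    rw [map_le_map_iff_isCompactOperator hstar hker hJ hS, sub_sub_cancel] at hle
    have hYW : Y ≤ (rangeSum P).topologicalClosure :=
      Submodule.topologicalClosure_mono (Submodule.span_le.2 (by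
        rintro _ ⟨k, rfl⟩
        exact hyW k))
    have hfin : FiniteDimensional 𝕜 Y := by
      -- The compact product fixes `Y` pointwise because `Y` lies below the join; yet `Y` contains
      -- an infinite orthonormal sequence.
      refine hle.finiteDimensional_of_fixed (Submodule.isClosed_topologicalClosure _) fun x hx => ?_
      have h1 : projJoin P x = x := Submodule.starProjection_eq_self_iff.2 (hYW hx)
      rw [mul_apply_eq_comp, h1, Submodule.starProjection_eq_self_iff.2 hx]
    have hli : LinearIndependent 𝕜 fun n => (⟨y n, Submodule.le_topologicalClosure _
        (Submodule.subset_span ⟨n, rfl⟩)⟩ : Y) :=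
      LinearIndependent.of_comp (Submodule.subtype _) hy.linearIndependent
    exact not_finite_iff_infinite.2 inferInstance hli.finite

end Calkin

/-! ### The main theorem -/

theorem mainTheorem6 {𝕜 H H' : Type*} [RCLike 𝕜]
    [NormedAddCommGroup H] [InnerProductSpace 𝕜 H] [CompleteSpace H]
    [NormedAddCommGroup H'] [InnerProductSpace 𝕜 H'] [CompleteSpace H']
    (π : (H →L[𝕜] H) →+* (H' →L[𝕜] H'))
    (hstar : ∀ T, π (star T) = star (π T))
    (hker : ∀ T, π T = 0 ↔ IsCompactOperator T)
    (P : ℕ → H →L[𝕜] H) (hP : ∀ n, IsStarProjection (P n)) :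
    (∀ R : H →L[𝕜] H, IsStarProjection R → R.range ≤ rangeSum P →
      (π R = projJoin (fun n => π (P n)) ↔ ¬ HasClosedInfDimExtension R.range (rangeSum P)) ∧
      (IsProjLUB (Set.range π) (fun n => π (P n)) (π R) ↔
        ¬ HasClosedInfDimExtension R.range (rangeSum P))) ∧
    (IsClosed (rangeSum P : Set H) ↔ π (projJoin P) = projJoin (fun n => π (P n))) ∧
    (IsClosed (rangeSum P : Set H) ↔
      IsProjLUB (Set.range π) (fun n => π (P n)) (π (projJoin P))) := by
  have hQ : ∀ n, IsStarProjection (π (P n)) := fun n => (hP n).map_of_map_star hstar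
  have hlub := isProjLUB_projJoin (fun n => π (P n)) hQ
  have key : ∀ R : H →L[𝕜] H, IsStarProjection R → R.range ≤ rangeSum P →
      (π R = projJoin (fun n => π (P n)) ↔ ¬ HasClosedInfDimExtension R.range (rangeSum P)) ∧
      (IsProjLUB (Set.range π) (fun n => π (P n)) (π R) ↔
        ¬ HasClosedInfDimExtension R.range (rangeSum P)) := by
    intro R hR hle
    rw [← forall_map_le_iff_not_hasClosedInfDimExtension hstar hker hP hR hle]
    have hπR := hR.map_of_map_star hstar
    refine ⟨⟨fun h n => h ▸ hlub.1.2.2 n, fun h => le_antisymm ?_ (hlub.2 ⟨trivial, hπR, h⟩)⟩,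
      ⟨fun h => h.1.2.2, fun h => ⟨⟨⟨R, rfl⟩, hπR, h⟩, ?_⟩⟩⟩
    · exact map_le_of_range_le_rangeSum hstar hP hR hle hlub.1.2.1 hlub.1.2.2
    · rintro T ⟨-, hT, hPT⟩
      exact map_le_of_range_le_rangeSum hstar hP hR hle hT hPT
  have hclosed : IsClosed (rangeSum P : Set H) →
      π (projJoin P) = projJoin (fun n => π (P n)) ∧
        IsProjLUB (Set.range π) (fun n => π (P n)) (π (projJoin P)) := by
    intro hc
    have hrange : (projJoin P).range = rangeSum P := by
      rw [projJoin, Submodule.range_starProjection]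
      exact hc.submodule_topologicalClosure_eq
    have h := key (projJoin P) isStarProjection_starProjection hrange.le
    have hno : ¬ HasClosedInfDimExtension (projJoin P).range (rangeSum P) := by
      rintro ⟨V, -, -, hVW, hinf⟩
      have htop : (projJoin P).range.submoduleOf V = ⊤ :=
        Submodule.submoduleOf_eq_top.2 (hVW.trans hrange.ge)
      have := Submodule.Quotient.subsingleton_iff.2 htop
      exact hinf inferInstance
    exact ⟨h.1.2 hno, h.2.2 hno⟩
  refine ⟨key, ⟨fun hc => (hclosed hc).1, fun h => ?_⟩, ⟨fun hc => (hclosed hc).2, fun h => ?_⟩⟩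
  -- The upper bound `π S` lies in the image of `π`, so it refutes both readings of the join.
  · by_contra hc
    obtain ⟨S, hS, hPS, hnot⟩ := exists_map_le_and_not_map_projJoin_le hstar hker hP hc
    exact hnot (h ▸ hlub.2 ⟨trivial, hS.map_of_map_star hstar, hPS⟩)
  · by_contra hc
    obtain ⟨S, hS, hPS, hnot⟩ := exists_map_le_and_not_map_projJoin_le hstar hker hP hc
    exact hnot (h.2 ⟨⟨S, rfl⟩, hS.map_of_map_star hstar, hPS⟩)
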